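/- Labeled graphs and state space. Let $V=\{0,\dots,n-1\}$ (the node IDs). A labeled graph is $\mathcal G=(V,E,w)$ with $(V,E)$ a simple undirected graph and $w\in\{0,1\}^V$; $\mathcal N_i$ is the set of neighbors of $i$, $d_i=|\mathcal N_i|$, and $\bar d$ is the average degree. Let $\mathcal G_0$ be a connected graph on $V$ and $k=\bar d(\mathcal G_0)$. Let $\mathbb G_{n,[k,k+2]}$ be the set of labeled graphs $(V,E,w)$ with $(V,E)$ connected and $|E|=kn/2+\sum_i w_i$. Let $M=\{m\in\mathbb N: k\le m\le k+2,\ mn/2\in\mathbb N\}$ and, for $m\in M$, let $\mathbb G^0_{n,m}$ be the set of $\mathcal G\in\mathbb G_{n,[k,k+2]}$ whose maximum and minimum degrees coincide and whose average degree is $m$. Transition probabilities. Let $\epsilon,\beta\in(0,1)$. One iteration of Algorithm II on $\mathcal G=(V,E,w)$ is the following random transformation. Independently, each node $i$ is inactive with probability $\epsilon$, and otherwise it picks a uniformly random node of $\mathcal N_i$ (no node if $\mathcal N_i=\emptyset$). Put $R_i=\{i'\in\mathcal N_i: i'\text{ picked }i\}$. Each matched pair, that is, each $i,j$ with $i\in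 R_j$ and $j\in R_i$, named so that $d_i\ge d_j$, is processed once (if $d_i=d_j$ the order of the two names is immaterial): independently for the different pairs, the node $\max\{i,j\}$ picks a rule uniformly from $\{r_1,r_2,r_3,r_4\}$, and then - $r_1$: if $d_i>d_j$ and $|R_i|\ge2$, $i$ picks a uniformly random $h\in R_i\setminus\{j\}$; if $(j,h)\notin E$, then with probability $1-\beta$ the edge $(i,h)$ is replaced by $(j,h)$, and with the remaining probability $\beta$, if $w_i=0$, the edge $(j,h)$ is added and $w_i$ becomes $1$; - $r_2$: if $|R_i|,|R_j|\ge2$, $i$ picks a uniformly random $h\in R_i\setminus\{j\}$ and, independently, $j$ picks a uniformly random $f\in R_j\setminus\{i\}$; if $(i,f)\notin E$ and $(j,h)\notin E$, the edges $(i,h),(j,f)$ are replaced by $(i,f),(j,h)$; - $r_3$: if $d_i>d_j$, $|R_i|\ge2$ and $w_i=1$, $i$ picks a uniformly random $h\in R_i\setminus\{j\}$; if $(j,h)\in E$, the edge $(i,h)$ is removed and $w_i$ becomes $0$; - $r_4$: $w_i$ and $w_j$ are swapped. In all other cases the pair changes nothing. (Different pairs involve disjoint sets of nodes, so all pairs may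 act concurrently.) Let $P^*(\mathcal G,\mathcal G')$ be the probability that one iteration transforms $\mathcal G$ into $\mathcal G'$. Lemma. For every $m\in M$ and all $\mathcal G,\mathcal G'\in\mathbb G^0_{n,m}$, $$P^*(\mathcal G,\mathcal G')=P^*(\mathcal G',\mathcal G).$$ -/

import Mathlib

open scoped ENNReal NNReal

noncomputable section

namespace RandReg

/-! ### Labeled graphs and the state space -/

/-- A labeled graph `(V, E, w)` on the node set `V = {0, …, n-1}` (the node IDs), with a binary
flag `w i ∈ {0, 1}` at every node.  The degree entry of a node label is determined by the graph. -/
@[ext]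
structure LabeledGraph (n : ℕ) where
  graph : SimpleGraph (Fin n)
  w : Fin n → Fin 2

variable {n : ℕ}

/-- The neighborhood `N_i`. -/
def nbhd (G : SimpleGraph (Fin n)) (i : Fin n) : Finset (Fin n) :=
  open scoped Classical in Finset.univ.filter (fun j => G.Adj i j)

/-- The degree `d_i = |N_i|`. -/
def deg (G : SimpleGraph (Fin n)) (i : Fin n) : ℕ := (nbhd G i).card

/-- The average degree. -/
def averageDegree (G : SimpleGraph (Fin n)) : ℝ := (∑ i, (deg G i : ℝ)) / n

/-- The degree range: maximum degree minus minimum degree. -/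
def degreeRange (G : SimpleGraph (Fin n)) : ℕ := (⨆ i, deg G i) - (⨅ i, deg G i)

/-- The state space: connected labeled graphs on `n` nodes with `|E| = k n / 2 + ∑ w_i`. -/
def stateSpace (n : ℕ) (k : ℝ) : Set (LabeledGraph n) :=
  {G | G.graph.Connected ∧
    (G.graph.edgeSet.ncard : ℝ) = k * n / 2 + ∑ i, ((G.w i : ℕ) : ℝ)}

/-- The regular graphs in the state space. -/
def regularStates (n : ℕ) (k : ℝ) : Set (LabeledGraph n) :=
  {G ∈ stateSpace n k | degreeRange G.graph = 0}

/-- The `m`-regular graphs in the state space. -/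
def regularStatesOfDegree (n : ℕ) (k : ℝ) (m : ℕ) : Set (LabeledGraph n) :=
  {G ∈ regularStates n k | averageDegree G.graph = m}

/-- The set `M` of naturals `m` with `k ≤ m ≤ k + 2` and `m n / 2 ∈ ℕ`. -/
def feasibleDegrees (n : ℕ) (k : ℝ) : Set ℕ :=
  {m | k ≤ m ∧ (m : ℝ) ≤ k + 2 ∧ ∃ t : ℕ, (m : ℝ) * n / 2 = t}

/-! ### Elementary random choices -/

/-- Independent draws, one from each `p i`. -/
def independent {ι α : Type} [Fintype ι] [DecidableEq ι] [Fintype α] (p : ι → PMF α) :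
    PMF (ι → α) :=
  PMF.ofFintype (fun x => ∏ i, p i (x i)) (by
    rw [← Fintype.piFinset_univ, ← Finset.prod_univ_sum]
    refine Finset.prod_eq_one fun i _ => ?_
    have h := (p i).tsum_coe
    rwa [tsum_fintype] at h)

/-- `true` with probability `p`, `false` with probability `1 - p`. -/
def coin (p : Set.Ioo (0 : ℝ) 1) : PMF Bool :=
  PMF.ofFintype (fun b => if b then ENNReal.ofReal p else ENNReal.ofReal (1 - p)) (by
    have h0 : (0 : ℝ) ≤ p := p.2.1.le
    have h1 : (0 : ℝ) ≤ 1 - p := sub_nonneg.2 p.2.2.le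
    simp [← ENNReal.ofReal_add h0 h1])

/-- A uniformly random element of `s` (`none` if there is nothing to choose from). -/
def uniformFrom {α : Type} (s : Finset α) : PMF (Option α) :=
  open scoped Classical in
  if h : s.Nonempty then (PMF.uniformOfFinset s h).map some else PMF.pure none

/-! ### One iteration of the algorithm -/

/-- The four rules of the grammar. -/
inductive Rule
  | r1 | r2 | r3 | r4
  deriving DecidableEq

instance : Fintype Rule where
  elems := {Rule.r1, Rule.r2, Rule.r3, Rule.r4}
  complete := by intro r; cases r <;> decide

instance : Nonempty Rule := ⟨Rule.r1⟩

/-- The pick of agent `i`: with probability `ε` it is inactive (`none`); otherwise it picks a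
neighbor uniformly at random. -/
def pickLaw (ε : Set.Ioo (0 : ℝ) 1) (G : LabeledGraph n) (i : Fin n) : PMF (Option (Fin n)) :=
  (coin ε).bind fun inactive =>
    if inactive then PMF.pure none else uniformFrom (nbhd G.graph i)

/-- `R_i`: the neighbors of `i` that picked `i`. -/
def pickers (G : LabeledGraph n) (u : Fin n → Option (Fin n)) (i : Fin n) : Finset (Fin n) :=
  (nbhd G.graph i).filter (fun k => u k = some i)

/-- The random choices of one agent after the picks have been made.  A choice which the algorithm
does not call for is ignored by `pairUpdate` below, so drawing it has no effect. -/
structure Choice (n : ℕ) where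
  /-- candidate rule, used if the agent has the larger ID in a matched pair -/
  rule : Rule
  /-- the agent chosen among those that picked this agent -/
  follower : Option (Fin n)
  /-- whether `β' < β` holds for this agent's random number `β' ∈ [0, 1]` -/
  small : Bool

instance : Fintype (Choice n) :=
  Fintype.ofInjective (fun c : Choice n => (c.rule, c.follower, c.small)) (by
    rintro ⟨r, h, b⟩ ⟨r', h', b'⟩ e
    simpa using e)

/-- The law of the choices of agent `i` given the picks `u`: the rule is uniform over the four
rules, the follower is uniform over `R_i` without the agent that `i` itself picked, and `β' < β`
has probability `β`; the three are independent. -/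
def choiceLaw (β : Set.Ioo (0 : ℝ) 1) (G : LabeledGraph n) (u : Fin n → Option (Fin n))
    (i : Fin n) : PMF (Choice n) :=
  (PMF.uniformOfFintype Rule).bind fun r =>
    (uniformFrom ((pickers G u i).filter (fun k => u i ≠ some k))).bind fun h =>
      (coin β).map fun b => ⟨r, h, b⟩

/-- The ordered pairs `(i, j)` processed in an iteration: `i ∈ R_j`, `j ∈ R_i` and `d_i ≥ d_j`.
Every matched pair is processed once; if the degrees are equal, the larger ID comes first. -/
def processedPairs (G : LabeledGraph n) (u : Fin n → Option (Fin n)) : Finset (Fin n × Fin n) :=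
  Finset.univ.filter fun p =>
    p.1 ∈ pickers G u p.2 ∧ p.2 ∈ pickers G u p.1 ∧
      (deg G.graph p.2 < deg G.graph p.1 ∨ deg G.graph p.1 = deg G.graph p.2 ∧ p.2 < p.1)

/-- A local modification of a labeled graph: edges to be removed, edges to be added, nodes whose
flag becomes `0`, nodes whose flag becomes `1`. -/
structure Update (n : ℕ) where
  removed : Set (Sym2 (Fin n))
  added : Set (Sym2 (Fin n))
  lowered : Set (Fin n)
  raised : Set (Fin n)

/-- The modification that changes nothing. -/
def Update.idle : Update n := ⟨∅, ∅, ∅, ∅⟩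

/-- What the processed pair `(i, j)` does, given the picks and the random choices. -/
def pairUpdate (G : LabeledGraph n) (u : Fin n → Option (Fin n)) (c : Fin n → Choice n)
    (i j : Fin n) : Update n :=
  open scoped Classical in
  match (c (max i j)).rule, (c i).follower, (c j).follower with
  | Rule.r1, some h, _ =>
    if deg G.graph j < deg G.graph i ∧ 2 ≤ (pickers G u i).card ∧ ¬ G.graph.Adj j h then
      if (c i).small = false then ⟨{s(i, h)}, {s(j, h)}, ∅, ∅⟩
      else if G.w i = 0 then ⟨∅, {s(j, h)}, ∅, {i}⟩
      else Update.idle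
    else Update.idle
  | Rule.r2, some h, some f =>
    if 2 ≤ (pickers G u i).card ∧ 2 ≤ (pickers G u j).card ∧
        ¬ G.graph.Adj i f ∧ ¬ G.graph.Adj j h then
      ⟨{s(i, h), s(j, f)}, {s(i, f), s(j, h)}, ∅, ∅⟩
    else Update.idle
  | Rule.r3, some h, _ =>
    if deg G.graph j < deg G.graph i ∧ 2 ≤ (pickers G u i).card ∧ G.w i = 1 ∧
        G.graph.Adj j h then
      ⟨{s(i, h)}, ∅, {i}, ∅⟩
    else Update.idle
  | Rule.r4, _, _ =>
    -- `i` and `j` swap their flags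
    ⟨∅, ∅, {v | v = i ∧ G.w j = 0 ∨ v = j ∧ G.w i = 0},
      {v | v = i ∧ G.w j = 1 ∨ v = j ∧ G.w i = 1}⟩
  | _, _, _ => Update.idle

/-- The labeled graph after all processed pairs have acted.  A node picks at most one neighbor, so
an agent chosen as a follower is itself unmatched and follows one pair only.  Hence different pairs
test and modify edges and flags on disjoint sets of nodes, and acting concurrently is the same as
acting one after the other in any order. -/
def nextGraph (G : LabeledGraph n) (u : Fin n → Option (Fin n)) (c : Fin n → Choice n) :
    LabeledGraph n :=
  open scoped Classical in
  { graph := SimpleGraph.fromEdgeSet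
      ((G.graph.edgeSet \ ⋃ p ∈ processedPairs G u, (pairUpdate G u c p.1 p.2).removed) ∪
        ⋃ p ∈ processedPairs G u, (pairUpdate G u c p.1 p.2).added)
    w := fun v =>
      if v ∈ ⋃ p ∈ processedPairs G u, (pairUpdate G u c p.1 p.2).raised then 1
      else if v ∈ ⋃ p ∈ processedPairs G u, (pairUpdate G u c p.1 p.2).lowered then 0
      else G.w v }

/-- One iteration: the agents pick independently, then make their random choices independently
given the picks, then the matched pairs act. -/
def iteration (ε β : Set.Ioo (0 : ℝ) 1) (G : LabeledGraph n) : PMF (LabeledGraph n) :=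
  (independent (pickLaw ε G)).bind fun u =>
    (independent (choiceLaw β G u)).map fun c => nextGraph G u c

/-- The transition probability `P*(G, G')`. -/
def transitionProb (ε β : Set.Ioo (0 : ℝ) 1) (G G' : LabeledGraph n) : ℝ≥0∞ :=
  iteration ε β G G'

end RandReg

end

namespace RandReg

variable {n : ℕ}

/-! ### Laws of the elementary choices -/

/-! All degrees equal `m`, so r1 and r3, which need a strict degree inequality, are inert: an
iteration only swaps edges (r2) and flags (r4). Both operations are involutions, and each can be
undone by an equally likely draw.

If the matched pair i, j with followers h, f swaps, then h ends up attached to j and f to i. In the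
reversed draw h picks j, f picks i, and i and j exchange followers; everything else is kept
(`revPicks`, `revChoices`). Followers are unmatched, so the matching is unchanged, the same pairs
swap (`swaps_rev`), and the iteration leads back (`nextGraph_rev`).

Probabilities agree because each pick is uniform over `m` neighbors before and after
(`pickLaw_rev`), and the candidate followers of i lose h and gain f, keeping their number
(`choiceLaw_rev`). Reversal is thus a weight-preserving bijection between the positive-probability
draws leading from `G` to `G'` and those leading back. -/

lemma independent_apply {ι α : Type} [Fintype ι] [DecidableEq ι] [Fintype α] (p : ι → PMF α)
    (x : ι → α) : independent p x = ∏ i, p i (x i) := rfl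

lemma uniformFrom_none {α : Type} (s : Finset α) :
    uniformFrom s none = if s.card = 0 then 1 else 0 := by
  classical
  unfold uniformFrom
  by_cases h : s.Nonempty
  · rw [dif_pos h, if_neg (Finset.card_pos.2 h).ne']
    simp [PMF.map_apply]
  · rw [dif_neg h, if_pos (by simpa using h)]
    simp

lemma uniformFrom_some {α : Type} {s : Finset α} {a : α} (ha : a ∈ s) :
    uniformFrom s (some a) = (s.card : ℝ≥0∞)⁻¹ := by
  classical
  have hs : s.Nonempty := ⟨a, ha⟩
  unfold uniformFrom
  rw [dif_pos hs, PMF.map_apply, tsum_eq_single a]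
  · rw [if_pos rfl, PMF.uniformOfFinset_apply, if_pos ha]
  · intro b hb
    simp [Ne.symm hb]

lemma uniformFrom_some_of_notMem {α : Type} {s : Finset α} {a : α} (ha : a ∉ s) :
    uniformFrom s (some a) = 0 := by
  classical
  unfold uniformFrom
  by_cases h : s.Nonempty
  · rw [dif_pos h, PMF.map_apply, ENNReal.tsum_eq_zero]
    intro b
    split_ifs with hb
    · cases hb
      simp [PMF.uniformOfFinset_apply, ha]
    · rfl
  · rw [dif_neg h]
    simp

lemma pickLaw_apply (ε : Set.Ioo (0 : ℝ) 1) (G : LabeledGraph n) (i : Fin n)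
    (x : Option (Fin n)) :
    pickLaw ε G i x = coin ε true * (PMF.pure none : PMF (Option (Fin n))) x
      + coin ε false * uniformFrom (nbhd G.graph i) x := by
  simp [pickLaw, PMF.bind_apply, tsum_fintype]

lemma choiceLaw_apply (β : Set.Ioo (0 : ℝ) 1) (G : LabeledGraph n) (u : Fin n → Option (Fin n))
    (i : Fin n) (c : Choice n) :
    choiceLaw β G u i c = PMF.uniformOfFintype Rule c.rule *
      (uniformFrom ((pickers G u i).filter (fun k => u i ≠ some k)) c.follower *
        coin β c.small) := by
  classical
  obtain ⟨r, h, b⟩ := c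
  unfold choiceLaw
  rw [PMF.bind_apply, tsum_eq_single r, PMF.bind_apply, tsum_eq_single h, PMF.map_apply,
    tsum_eq_single b]
  · simp
  · intro b' hb; simp [Ne.symm hb]
  · intro h' hh
    simp [PMF.map_apply, Ne.symm hh]
  · intro r' hr
    simp [PMF.map_apply, PMF.bind_apply, Ne.symm hr]

/-! ### Outcomes of positive probability -/

/-- Picks and followers that can occur: agents pick neighbors, and a follower of `i` is an agent
that picked `i` and was not picked by `i`. -/
structure IsOutcome (G : LabeledGraph n) (u : Fin n → Option (Fin n)) (c : Fin n → Choice n) :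
    Prop where
  adj : ∀ {x y}, u x = some y → G.graph.Adj x y
  pick : ∀ {i h}, (c i).follower = some h → u h = some i
  ne : ∀ {i h}, (c i).follower = some h → u i ≠ some h

/-- The agents `i` and `j` picked each other. -/
def Matched (u : Fin n → Option (Fin n)) (i j : Fin n) : Prop :=
  u i = some j ∧ u j = some i

/-- The matched pair `i, j` exchanges the edges to its followers. -/
def Swaps (G : LabeledGraph n) (u : Fin n → Option (Fin n)) (c : Fin n → Choice n)
    (i j : Fin n) : Prop :=
  Matched u i j ∧ (c (max i j)).rule = Rule.r2 ∧ ∃ h f, (c i).follower = some h ∧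
    (c j).follower = some f ∧ ¬ G.graph.Adj i f ∧ ¬ G.graph.Adj j h

/-- The matched pair `i, j` exchanges its flags. -/
def SwapsFlags (u : Fin n → Option (Fin n)) (c : Fin n → Choice n) (i j : Fin n) : Prop :=
  Matched u i j ∧ (c (max i j)).rule = Rule.r4

/-- The agent `x` loses the edge to its pick. -/
def Moves (G : LabeledGraph n) (u : Fin n → Option (Fin n)) (c : Fin n → Choice n)
    (x : Fin n) : Prop :=
  ∃ i j, Swaps G u c i j ∧ (c i).follower = some x

/-- The edges deleted in an iteration on a regular graph. -/
def Removed (G : LabeledGraph n) (u : Fin n → Option (Fin n)) (c : Fin n → Choice n)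
    (e : Sym2 (Fin n)) : Prop :=
  -- `Swaps` is symmetric, so the two orders of a pair supply both of its edges.
  ∃ i j h, Swaps G u c i j ∧ (c i).follower = some h ∧ e = s(i, h)

/-- The edges created in an iteration on a regular graph. -/
def Added (G : LabeledGraph n) (u : Fin n → Option (Fin n)) (c : Fin n → Choice n)
    (e : Sym2 (Fin n)) : Prop :=
  ∃ i j f, Swaps G u c i j ∧ (c j).follower = some f ∧ e = s(i, f)

open scoped Classical in
/-- The picks that undo an iteration. -/
noncomputable def revPicks (G : LabeledGraph n) (u : Fin n → Option (Fin n)) (c : Fin n → Choice n)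
    (x : Fin n) : Option (Fin n) :=
  -- A moving agent picked i and i picked its partner j, so following picks twice yields j, the new
  -- neighbor.
  if Moves G u c x then (u x).bind u else u x

open scoped Classical in
/-- The choices that undo an iteration. -/
noncomputable def revChoices (G : LabeledGraph n) (u : Fin n → Option (Fin n)) (c : Fin n → Choice n)
    (i : Fin n) : Choice n :=
  if ∃ j, Swaps G u c i j then
    ⟨(c i).rule, (u i).bind fun j => (c j).follower, (c i).small⟩
  else c i

variable {G G' : LabeledGraph n} {u : Fin n → Option (Fin n)} {c : Fin n → Choice n}

lemma Matched.symm {i j : Fin n} (h : Matched u i j) : Matched u j i := ⟨h.2, h.1⟩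

lemma Matched.right_unique {i j k : Fin n} (h : Matched u i j) (h' : Matched u i k) : j = k :=
  Option.some_injective _ (h.1.symm.trans h'.1)

lemma Swaps.symm {i j : Fin n} (hs : Swaps G u c i j) : Swaps G u c j i := by
  obtain ⟨hm, hr, h, f, hh, hf, h1, h2⟩ := hs
  exact ⟨hm.symm, max_comm i j ▸ hr, f, h, hf, hh, h2, h1⟩

lemma Swaps.right_unique {i j k : Fin n} (h : Swaps G u c i j) (h' : Swaps G u c i k) : j = k :=
  h.1.right_unique h'.1

lemma Swaps.not_adj {i j f : Fin n} (hs : Swaps G u c i j) (hf : (c j).follower = some f) :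
    ¬ G.graph.Adj i f := by
  obtain ⟨_, _, h, f', _, hf', h1, _⟩ := hs
  rw [hf] at hf'
  cases hf'
  exact h1

namespace IsOutcome

lemma matched_ne (o : IsOutcome G u c) {i j : Fin n} (h : Matched u i j) : i ≠ j :=
  (o.adj h.1).ne

/-- A follower is unmatched. -/
lemma not_matched (o : IsOutcome G u c) {i h j : Fin n} (hh : (c i).follower = some h) :
    ¬ Matched u h j := by
  intro hm
  have h1 := o.pick hh
  rw [hm.1] at h1
  cases h1
  exact o.ne hh hm.2

lemma revPicks_of_follower (o : IsOutcome G u c) {i j h : Fin n} (hs : Swaps G u c i j)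
    (hh : (c i).follower = some h) : revPicks G u c h = some j := by
  rw [revPicks, if_pos ⟨i, j, hs, hh⟩, o.pick hh]
  exact hs.1.1

lemma revPicks_of_matched (o : IsOutcome G u c) {i j : Fin n} (hm : Matched u i j) :
    revPicks G u c i = some j := by
  rw [revPicks, if_neg, hm.1]
  rintro ⟨k, l, -, hk⟩
  exact o.not_matched hk hm

lemma revPicks_of_not_moves {x : Fin n} (hx : ¬ Moves G u c x) : revPicks G u c x = u x :=
  if_neg hx

/-- A moving agent now picks a matched agent, whose own pick remains its old partner, so no new
mutual pick arises. Matched agents do not move, so no old one is lost. -/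
lemma matched_revPicks (o : IsOutcome G u c) {i j : Fin n} :
    Matched (revPicks G u c) i j ↔ Matched u i j := by
  have key : ∀ {i j}, Matched (revPicks G u c) i j → ¬ Moves G u c i := by
    rintro i j hm ⟨k, l, hs, hk⟩
    have h1 := hm.1
    rw [o.revPicks_of_follower hs hk] at h1
    cases h1
    have h2 := hm.2
    rw [o.revPicks_of_matched hs.1.symm] at h2
    cases h2
    exact (o.adj (o.pick hk)).ne rfl
  constructor
  · intro hm
    refine ⟨?_, ?_⟩
    · rw [← hm.1, revPicks_of_not_moves (key hm)]
    · rw [← hm.2, revPicks_of_not_moves (key hm.symm)]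
  · intro hm
    exact ⟨o.revPicks_of_matched hm, o.revPicks_of_matched hm.symm⟩

end IsOutcome

lemma revChoices_follower {i j : Fin n} (hs : Swaps G u c i j) :
    (revChoices G u c i).follower = (c j).follower := by
  rw [revChoices, if_pos ⟨j, hs⟩, hs.1.1]
  rfl

lemma revChoices_of_not_swaps {i : Fin n} (hs : ¬ ∃ j, Swaps G u c i j) :
    revChoices G u c i = c i := if_neg hs

lemma revChoices_rule (i : Fin n) : (revChoices G u c i).rule = (c i).rule := by
  unfold revChoices; split_ifs <;> rfl

lemma revChoices_small (i : Fin n) : (revChoices G u c i).small = (c i).small := by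
  unfold revChoices; split_ifs <;> rfl

/-! ### One iteration on a regular graph -/

lemma mem_pickers {i k : Fin n} : k ∈ pickers G u i ↔ G.graph.Adj i k ∧ u k = some i := by
  simp [pickers, nbhd]

namespace IsOutcome

lemma mem_pickers (o : IsOutcome G u c) {i k : Fin n} : k ∈ pickers G u i ↔ u k = some i := by
  rw [RandReg.mem_pickers]
  exact ⟨fun h => h.2, fun h => ⟨(o.adj h).symm, h⟩⟩

lemma mem_processedPairs (o : IsOutcome G u c) (hd : ∀ i j, deg G.graph i = deg G.graph j)
    {p : Fin n × Fin n} : p ∈ processedPairs G u ↔ Matched u p.1 p.2 ∧ p.2 < p.1 := by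
  simp only [processedPairs, Finset.mem_filter, Finset.mem_univ, true_and, o.mem_pickers,
    hd p.2 p.1, lt_irrefl, false_or, Matched, and_assoc]

/-- The partner and the follower are distinct pickers. Hence the cardinality tests of r2 are
automatic, and `Swaps` omits them. -/
lemma two_le_card_pickers (o : IsOutcome G u c) {i j h : Fin n} (hm : Matched u i j)
    (hh : (c i).follower = some h) : 2 ≤ (pickers G u i).card := by
  have hne : j ≠ h := by
    rintro rfl
    exact o.ne hh hm.1
  rw [← Finset.card_pair hne]
  refine Finset.card_le_card ?_
  intro k hk
  rw [Finset.mem_insert, Finset.mem_singleton] at hk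
  rw [o.mem_pickers]
  rcases hk with rfl | rfl
  · exact hm.2
  · exact o.pick hh

lemma mem_removed (o : IsOutcome G u c) (hd : ∀ i j, deg G.graph i = deg G.graph j)
    {i j : Fin n} (hm : Matched u i j) (e : Sym2 (Fin n)) :
    e ∈ (pairUpdate G u c i j).removed ↔ Swaps G u c i j ∧
      ((∃ h, (c i).follower = some h ∧ e = s(i, h)) ∨
        ∃ f, (c j).follower = some f ∧ e = s(j, f)) := by
  rcases hr : (c (max i j)).rule <;> rcases hi : (c i).follower with _ | h <;>
    rcases hj : (c j).follower with _ | f <;>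
    simp [pairUpdate, Swaps, hr, hi, hj, hm, hd i j, Update.idle]
  -- Only r2 with both followers present is left: r1 and r3 fail their degree test, r4 touches no
  -- edge.
  split_ifs with hc
  · simp [hc]
  · have h1 := o.two_le_card_pickers hm hi
    have h2 := o.two_le_card_pickers hm.symm hj
    simp only [h1, h2, true_and] at hc
    simp only [Set.mem_empty_iff_false, false_iff]
    exact fun hh => hc hh.1

lemma mem_added (o : IsOutcome G u c) (hd : ∀ i j, deg G.graph i = deg G.graph j)
    {i j : Fin n} (hm : Matched u i j) (e : Sym2 (Fin n)) :
    e ∈ (pairUpdate G u c i j).added ↔ Swaps G u c i j ∧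
      ((∃ f, (c j).follower = some f ∧ e = s(i, f)) ∨
        ∃ h, (c i).follower = some h ∧ e = s(j, h)) := by
  rcases hr : (c (max i j)).rule <;> rcases hi : (c i).follower with _ | h <;>
    rcases hj : (c j).follower with _ | f <;>
    simp [pairUpdate, Swaps, hr, hi, hj, hm, hd i j, Update.idle]
  split_ifs with hc
  · simp [hc]
  · have h1 := o.two_le_card_pickers hm hi
    have h2 := o.two_le_card_pickers hm.symm hj
    simp only [h1, h2, true_and] at hc
    simp only [Set.mem_empty_iff_false, false_iff]
    exact fun hh => hc hh.1

lemma mem_raised (hd : ∀ i j, deg G.graph i = deg G.graph j) {i j v : Fin n}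
    (hm : Matched u i j) :
    v ∈ (pairUpdate G u c i j).raised ↔ SwapsFlags u c i j ∧
      (v = i ∧ G.w j = 1 ∨ v = j ∧ G.w i = 1) := by
  rcases hr : (c (max i j)).rule <;> rcases hi : (c i).follower with _ | h <;>
    rcases hj : (c j).follower with _ | f <;>
    simp [pairUpdate, SwapsFlags, hr, hi, hj, hm, hd i j, Update.idle]
  split_ifs <;> simp

lemma mem_lowered (hd : ∀ i j, deg G.graph i = deg G.graph j) {i j v : Fin n}
    (hm : Matched u i j) :
    v ∈ (pairUpdate G u c i j).lowered ↔ SwapsFlags u c i j ∧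
      (v = i ∧ G.w j = 0 ∨ v = j ∧ G.w i = 0) := by
  rcases hr : (c (max i j)).rule <;> rcases hi : (c i).follower with _ | h <;>
    rcases hj : (c j).follower with _ | f <;>
    simp [pairUpdate, SwapsFlags, hr, hi, hj, hm, hd i j, Update.idle]
  split_ifs <;> simp

lemma mem_iUnion_processedPairs (o : IsOutcome G u c)
    (hd : ∀ i j, deg G.graph i = deg G.graph j) {α : Type} (F : Fin n → Fin n → Set α)
    (x : α) : x ∈ ⋃ p ∈ processedPairs G u, F p.1 p.2 ↔
      ∃ i j, Matched u i j ∧ j < i ∧ x ∈ F i j := by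
  simp only [Set.mem_iUnion, o.mem_processedPairs hd, Prod.exists, exists_prop, and_assoc]

/-- A disjunction symmetric in the two members of a pair, over pairs listed once. -/
lemma exists_ordered (o : IsOutcome G u c) {Q : Fin n → Fin n → Prop} {P : Fin n → Fin n → Prop}
    (hQ : ∀ i j, Q i j → Q j i) (hm : ∀ i j, Q i j → Matched u i j) :
    (∃ i j, Matched u i j ∧ j < i ∧ Q i j ∧ (P i j ∨ P j i)) ↔ ∃ i j, Q i j ∧ P i j := by
  constructor
  · rintro ⟨i, j, -, -, hq, hp | hp⟩
    · exact ⟨i, j, hq, hp⟩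
    · exact ⟨j, i, hQ _ _ hq, hp⟩
  · rintro ⟨i, j, hq, hp⟩
    rcases lt_or_gt_of_ne (o.matched_ne (hm _ _ hq)) with h | h
    · exact ⟨j, i, hm _ _ (hQ _ _ hq), h, hQ _ _ hq, Or.inr hp⟩
    · exact ⟨i, j, hm _ _ hq, h, hq, Or.inl hp⟩

lemma nextGraph_adj (o : IsOutcome G u c) (hd : ∀ i j, deg G.graph i = deg G.graph j)
    (a b : Fin n) : (nextGraph G u c).graph.Adj a b ↔
      ((G.graph.Adj a b ∧ ¬ Removed G u c s(a, b)) ∨ Added G u c s(a, b)) ∧ a ≠ b := by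
  have h1 : s(a, b) ∈ (⋃ p ∈ processedPairs G u, (pairUpdate G u c p.1 p.2).removed) ↔
      Removed G u c s(a, b) := by
    rw [o.mem_iUnion_processedPairs hd fun i j => (pairUpdate G u c i j).removed]
    have := o.exists_ordered (Q := Swaps G u c)
      (P := fun i j => ∃ h, (c i).follower = some h ∧ s(a, b) = s(i, h))
      (fun _ _ h => h.symm) (fun _ _ h => h.1)
    simp only [Removed, ← exists_and_left] at this ⊢
    rw [← this]
    refine exists_congr fun i => exists_congr fun j => and_congr_right fun hm => ?_
    rw [o.mem_removed hd hm]
  have h2 : s(a, b) ∈ (⋃ p ∈ processedPairs G u, (pairUpdate G u c p.1 p.2).added) ↔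
      Added G u c s(a, b) := by
    rw [o.mem_iUnion_processedPairs hd fun i j => (pairUpdate G u c i j).added]
    have := o.exists_ordered (Q := Swaps G u c)
      (P := fun i j => ∃ f, (c j).follower = some f ∧ s(a, b) = s(i, f))
      (fun _ _ h => h.symm) (fun _ _ h => h.1)
    simp only [Added, ← exists_and_left] at this ⊢
    rw [← this]
    refine exists_congr fun i => exists_congr fun j => and_congr_right fun hm => ?_
    rw [o.mem_added hd hm]
  simp only [nextGraph, SimpleGraph.fromEdgeSet_adj, Set.mem_union, Set.mem_sdiff, h1, h2,
    SimpleGraph.mem_edgeSet]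

lemma nextGraph_raised (o : IsOutcome G u c) (hd : ∀ i j, deg G.graph i = deg G.graph j)
    (v : Fin n) : v ∈ (⋃ p ∈ processedPairs G u, (pairUpdate G u c p.1 p.2).raised) ↔
      ∃ j, SwapsFlags u c v j ∧ G.w j = 1 := by
  rw [o.mem_iUnion_processedPairs hd fun i j => (pairUpdate G u c i j).raised]
  have := o.exists_ordered (Q := SwapsFlags u c) (P := fun i j => v = i ∧ G.w j = 1)
    (fun i j h => ⟨h.1.symm, max_comm i j ▸ h.2⟩) (fun _ _ h => h.1)
  refine Iff.trans ?_ (this.trans ?_)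
  · refine exists_congr fun i => exists_congr fun j => and_congr_right fun hm => ?_
    rw [mem_raised hd hm]
  · constructor
    · rintro ⟨i, j, h, rfl, h'⟩
      exact ⟨j, h, h'⟩
    · rintro ⟨j, h, h'⟩
      exact ⟨v, j, h, rfl, h'⟩

lemma nextGraph_lowered (o : IsOutcome G u c) (hd : ∀ i j, deg G.graph i = deg G.graph j)
    (v : Fin n) : v ∈ (⋃ p ∈ processedPairs G u, (pairUpdate G u c p.1 p.2).lowered) ↔
      ∃ j, SwapsFlags u c v j ∧ G.w j = 0 := by
  rw [o.mem_iUnion_processedPairs hd fun i j => (pairUpdate G u c i j).lowered]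
  have := o.exists_ordered (Q := SwapsFlags u c) (P := fun i j => v = i ∧ G.w j = 0)
    (fun i j h => ⟨h.1.symm, max_comm i j ▸ h.2⟩) (fun _ _ h => h.1)
  refine Iff.trans ?_ (this.trans ?_)
  · refine exists_congr fun i => exists_congr fun j => and_congr_right fun hm => ?_
    rw [mem_lowered hd hm]
  · constructor
    · rintro ⟨i, j, h, rfl, h'⟩
      exact ⟨j, h, h'⟩
    · rintro ⟨j, h, h'⟩
      exact ⟨v, j, h, rfl, h'⟩

lemma nextGraph_w_of_swapsFlags (o : IsOutcome G u c)
    (hd : ∀ i j, deg G.graph i = deg G.graph j) {v j : Fin n} (hs : SwapsFlags u c v j) :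
    (nextGraph G u c).w v = G.w j := by
  have h1 := o.nextGraph_raised hd v
  have h0 := o.nextGraph_lowered hd v
  have key : ∀ a, (∃ k, SwapsFlags u c v k ∧ G.w k = a) ↔ G.w j = a := by
    refine fun a => ⟨?_, fun h => ⟨j, hs, h⟩⟩
    rintro ⟨k, hk, rfl⟩
    rw [hs.1.right_unique hk.1]
  rw [key] at h1 h0
  simp only [nextGraph]
  split_ifs with ha hb
  · exact (h1.1 ha).symm
  · exact (h0.1 hb).symm
  -- Impossible: the partner's flag is 0 or 1, so `v` is either raised or lowered.
  · have := mt h1.2 ha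
    have := mt h0.2 hb
    omega

lemma nextGraph_w_of_not_swapsFlags (o : IsOutcome G u c)
    (hd : ∀ i j, deg G.graph i = deg G.graph j) {v : Fin n} (hs : ¬ ∃ j, SwapsFlags u c v j) :
    (nextGraph G u c).w v = G.w v := by
  simp only [nextGraph]
  rw [if_neg, if_neg]
  · rw [o.nextGraph_lowered hd]
    exact fun ⟨j, h, _⟩ => hs ⟨j, h⟩
  · rw [o.nextGraph_raised hd]
    exact fun ⟨j, h, _⟩ => hs ⟨j, h⟩

/-! ### The reversed outcome -/

lemma adj_of_removed (o : IsOutcome G u c) {a b : Fin n} (h : Removed G u c s(a, b)) :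
    G.graph.Adj a b := by
  obtain ⟨i, j, h, -, hh, he⟩ := h
  rw [← SimpleGraph.mem_edgeSet, he, SimpleGraph.mem_edgeSet]
  exact (o.adj (o.pick hh)).symm

lemma not_adj_of_added {a b : Fin n} (h : Added G u c s(a, b)) : ¬ G.graph.Adj a b := by
  obtain ⟨i, j, f, hs, hf, he⟩ := h
  rw [← SimpleGraph.mem_edgeSet, he, SimpleGraph.mem_edgeSet]
  exact hs.not_adj hf

/-- An edge removed at a matched agent goes to the follower of that agent. -/
lemma removed_matched (o : IsOutcome G u c) {i j x : Fin n} (hm : Matched u i j)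
    (h : Removed G u c s(i, x)) : Swaps G u c i j ∧ (c i).follower = some x := by
  obtain ⟨k, l, y, hs, hy, he⟩ := h
  rw [Sym2.eq_iff] at he
  rcases he with ⟨rfl, rfl⟩ | ⟨rfl, rfl⟩
  · rw [hm.right_unique hs.1]
    exact ⟨hs, hy⟩
  · exact (o.not_matched hy hm).elim

/-- An edge created at a matched agent goes to the follower of its partner. -/
lemma added_matched (o : IsOutcome G u c) {i j x : Fin n} (hm : Matched u i j)
    (h : Added G u c s(i, x)) : Swaps G u c i j ∧ (c j).follower = some x := by
  obtain ⟨k, l, y, hs, hy, he⟩ := h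
  rw [Sym2.eq_iff] at he
  rcases he with ⟨rfl, rfl⟩ | ⟨rfl, rfl⟩
  · rw [hm.right_unique hs.1]
    exact ⟨hs, hy⟩
  · exact (o.not_matched hy hm).elim

lemma matched_ne_follower (o : IsOutcome G u c) {i j k h : Fin n} (hm : Matched u i j)
    (hh : (c k).follower = some h) : i ≠ h := by
  rintro rfl
  exact o.not_matched hh hm

/-- Edges at a matched agent change only through the swap of its own pair. So a blocked pair stays
blocked, and a swapped pair finds its former edges gone, which is the test for swapping back. -/
lemma swaps_rev (o : IsOutcome G u c) (hd : ∀ i j, deg G.graph i = deg G.graph j)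
    (hG' : nextGraph G u c = G') {i j : Fin n} :
    Swaps G' (revPicks G u c) (revChoices G u c) i j ↔ Swaps G u c i j := by
  subst hG'
  have key : ∀ {i j f : Fin n}, Swaps G u c i j → (c i).follower = some f →
      ¬ (nextGraph G u c).graph.Adj i f := by
    intro i j f hs hf
    rw [o.nextGraph_adj hd]
    rintro ⟨⟨-, hr⟩ | ha, -⟩
    · exact hr ⟨i, j, f, hs, hf, rfl⟩
    -- Had the edge been created again, `f` would be a follower of both `i` and `j`, hence would
    -- have picked both.
    · have h1 := o.pick hf
      rw [o.pick (o.added_matched hs.1 ha).2] at h1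
      cases h1
      exact o.matched_ne hs.1 rfl
  constructor
  · rintro ⟨hm, hr, h, f, hh, hf, h1, h2⟩
    rw [o.matched_revPicks] at hm
    rw [revChoices_rule] at hr
    by_contra hs
    have hsi : ¬ ∃ k, Swaps G u c i k := by
      rintro ⟨k, hk⟩
      rw [hm.right_unique hk.1] at hs
      exact hs hk
    have hsj : ¬ ∃ k, Swaps G u c j k := by
      rintro ⟨k, hk⟩
      rw [hm.symm.right_unique hk.1] at hs
      exact hs hk.symm
    rw [revChoices_of_not_swaps hsi] at hh
    rw [revChoices_of_not_swaps hsj] at hf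
    rw [o.nextGraph_adj hd] at h1 h2
    refine hs ⟨hm, hr, h, f, hh, hf, fun ha => h1 ⟨Or.inl ⟨ha, fun hrem => ?_⟩, ha.ne⟩,
      fun ha => h2 ⟨Or.inl ⟨ha, fun hrem => ?_⟩, ha.ne⟩⟩
    · exact hs (o.removed_matched hm hrem).1
    · exact hs (o.removed_matched hm.symm hrem).1.symm
  · intro hs
    obtain ⟨hm, hr, h, f, hh, hf, h1, h2⟩ := id hs
    refine ⟨o.matched_revPicks.2 hm, by rwa [revChoices_rule], f, h, ?_, ?_, ?_, ?_⟩
    · rw [revChoices_follower hs, hf]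
    · rw [revChoices_follower hs.symm, hh]
    · exact key hs hh
    · exact key hs.symm hf

lemma swapsFlags_rev (o : IsOutcome G u c) {i j : Fin n} :
    SwapsFlags (revPicks G u c) (revChoices G u c) i j ↔ SwapsFlags u c i j := by
  rw [SwapsFlags, SwapsFlags, o.matched_revPicks, revChoices_rule]

lemma removed_rev (o : IsOutcome G u c) (hd : ∀ i j, deg G.graph i = deg G.graph j)
    (hG' : nextGraph G u c = G') {e : Sym2 (Fin n)} :
    Removed G' (revPicks G u c) (revChoices G u c) e ↔ Added G u c e := by
  refine exists_congr fun i => exists_congr fun j => exists_congr fun h => ?_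
  rw [o.swaps_rev hd hG']
  refine and_congr_right fun hs => ?_
  rw [revChoices_follower hs]

lemma added_rev (o : IsOutcome G u c) (hd : ∀ i j, deg G.graph i = deg G.graph j)
    (hG' : nextGraph G u c = G') {e : Sym2 (Fin n)} :
    Added G' (revPicks G u c) (revChoices G u c) e ↔ Removed G u c e := by
  refine exists_congr fun i => exists_congr fun j => exists_congr fun h => ?_
  rw [o.swaps_rev hd hG']
  refine and_congr_right fun hs => ?_
  rw [revChoices_follower hs.symm]

lemma moves_rev (o : IsOutcome G u c) (hd : ∀ i j, deg G.graph i = deg G.graph j)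
    (hG' : nextGraph G u c = G') {x : Fin n} :
    Moves G' (revPicks G u c) (revChoices G u c) x ↔ Moves G u c x := by
  simp only [Moves, o.swaps_rev hd hG']
  constructor
  · rintro ⟨i, j, hs, hx⟩
    rw [revChoices_follower hs] at hx
    exact ⟨j, i, hs.symm, hx⟩
  · rintro ⟨i, j, hs, hx⟩
    refine ⟨j, i, hs.symm, ?_⟩
    rw [revChoices_follower hs.symm, hx]

lemma revPicks_rev (o : IsOutcome G u c) (hd : ∀ i j, deg G.graph i = deg G.graph j)
    (hG' : nextGraph G u c = G') :
    revPicks G' (revPicks G u c) (revChoices G u c) = u := by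
  funext x
  by_cases hx : Moves G u c x
  · rw [revPicks, if_pos ((o.moves_rev hd hG').2 hx)]
    obtain ⟨i, j, hs, hf⟩ := hx
    rw [o.revPicks_of_follower hs hf, Option.bind_some, o.revPicks_of_matched hs.1.symm,
      o.pick hf]
  · rw [revPicks, if_neg (mt (o.moves_rev hd hG').1 hx), revPicks_of_not_moves hx]

lemma revChoices_rev (o : IsOutcome G u c) (hd : ∀ i j, deg G.graph i = deg G.graph j)
    (hG' : nextGraph G u c = G') :
    revChoices G' (revPicks G u c) (revChoices G u c) = c := by
  funext i
  by_cases hi : ∃ j, Swaps G u c i j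
  · obtain ⟨j, hs⟩ := hi
    rw [revChoices, if_pos ⟨j, (o.swaps_rev hd hG').2 hs⟩, revChoices_rule, revChoices_small,
      o.revPicks_of_matched hs.1, Option.bind_some, revChoices_follower hs.symm]
  · rw [revChoices, if_neg, revChoices_of_not_swaps hi]
    simpa only [o.swaps_rev hd hG'] using hi

/-- The agents that picked `i` in the reversed outcome. -/
lemma revPicks_eq_some_iff (o : IsOutcome G u c) {i k : Fin n} (hi : ¬ ∃ j, Swaps G u c i j) :
    revPicks G u c k = some i ↔ u k = some i := by
  by_cases hk : Moves G u c k
  · obtain ⟨a, b, hs, hf⟩ := hk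
    -- The old and new picks of a moving agent both belong to a swapping pair, so neither is `i`.
    rw [o.revPicks_of_follower hs hf, o.pick hf, Option.some_inj, Option.some_inj]
    constructor
    · rintro rfl
      exact (hi ⟨_, hs.symm⟩).elim
    · rintro rfl
      exact (hi ⟨_, hs⟩).elim
  · rw [revPicks_of_not_moves hk]

/-- A moving agent now picks along a created edge. Any other agent keeps its pick, and that edge
survives, since a removed edge joins a follower to the agent it picked. -/
lemma rev (o : IsOutcome G u c) (hd : ∀ i j, deg G.graph i = deg G.graph j)
    (hG' : nextGraph G u c = G') : IsOutcome G' (revPicks G u c) (revChoices G u c) := by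
  have hpick : ∀ {i h}, (revChoices G u c i).follower = some h → revPicks G u c h = some i := by
    intro i h hh
    by_cases hi : ∃ j, Swaps G u c i j
    · obtain ⟨j, hs⟩ := hi
      rw [revChoices_follower hs] at hh
      exact o.revPicks_of_follower hs.symm hh
    · rw [revChoices_of_not_swaps hi] at hh
      rw [o.revPicks_eq_some_iff hi, o.pick hh]
  refine ⟨?_, hpick, ?_⟩
  · intro x y hxy
    rw [← hG', o.nextGraph_adj hd]
    by_cases hx : Moves G u c x
    · obtain ⟨i, j, hs, hf⟩ := hx
      rw [o.revPicks_of_follower hs hf] at hxy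
      cases hxy
      refine ⟨Or.inr ⟨y, i, x, hs.symm, hf, Sym2.eq_swap⟩, ?_⟩
      exact (o.matched_ne_follower hs.1.symm hf).symm
    · rw [revPicks_of_not_moves hx] at hxy
      refine ⟨Or.inl ⟨o.adj hxy, ?_⟩, (o.adj hxy).ne⟩
      rintro ⟨i, j, h, hs, hf, he⟩
      rw [Sym2.eq_iff] at he
      rcases he with ⟨rfl, rfl⟩ | ⟨rfl, rfl⟩
      · rw [hs.1.1] at hxy
        cases hxy
        exact o.not_matched hf hs.1.symm
      · exact hx ⟨y, j, hs, hf⟩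
  · intro i h hh hih
    have hm := o.matched_revPicks.1 ⟨hih, hpick hh⟩
    by_cases hi : ∃ j, Swaps G u c i j
    · obtain ⟨j, hs⟩ := hi
      rw [revChoices_follower hs] at hh
      exact o.not_matched hh hm.symm
    · rw [revChoices_of_not_swaps hi] at hh
      exact o.not_matched hh hm.symm

/-- Removed edges were present, created ones absent, and reversal interchanges the two sets. Flag
swaps undo themselves. Regularity of `G'` keeps r1 and r3 inert on the way back. -/
lemma nextGraph_rev (o : IsOutcome G u c) (hd : ∀ i j, deg G.graph i = deg G.graph j)
    (hd' : ∀ i j, deg G'.graph i = deg G'.graph j) (hG' : nextGraph G u c = G') :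
    nextGraph G' (revPicks G u c) (revChoices G u c) = G := by
  have o' := o.rev hd hG'
  ext a b
  · rw [o'.nextGraph_adj hd', o.removed_rev hd hG', o.added_rev hd hG', ← hG',
      o.nextGraph_adj hd]
    have h1 := o.adj_of_removed (a := a) (b := b)
    have h2 := not_adj_of_added (G := G) (u := u) (c := c) (a := a) (b := b)
    have h3 : G.graph.Adj a b → a ≠ b := fun h => h.ne
    tauto
  · congr 1
    by_cases hs : ∃ j, SwapsFlags u c a j
    · obtain ⟨j, hs⟩ := hs
      rw [o'.nextGraph_w_of_swapsFlags hd' (o.swapsFlags_rev.2 hs), ← hG',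
        o.nextGraph_w_of_swapsFlags hd ⟨hs.1.symm, max_comm a j ▸ hs.2⟩]
    · rw [o'.nextGraph_w_of_not_swapsFlags hd' (by simpa only [o.swapsFlags_rev] using hs), ← hG',
        o.nextGraph_w_of_not_swapsFlags hd hs]

/-! ### Equality of the probabilities -/

/-- The probability of picking a given neighbor depends only on the degree. -/
lemma pickLaw_rev (o : IsOutcome G u c) (hd : ∀ i j, deg G.graph i = deg G.graph j)
    (hG' : nextGraph G u c = G') (ε : Set.Ioo (0 : ℝ) 1) (x : Fin n)
    (hx : deg G'.graph x = deg G.graph x) :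
    pickLaw ε G' x (revPicks G u c x) = pickLaw ε G x (u x) := by
  have o' := o.rev hd hG'
  unfold deg at hx
  rw [pickLaw_apply, pickLaw_apply]
  rcases hu : u x with _ | y
  · have hu' : revPicks G u c x = none := by
      unfold revPicks
      split_ifs <;> simp [hu]
    rw [hu', uniformFrom_none, uniformFrom_none, hx]
  · obtain ⟨z, hz⟩ : ∃ z, revPicks G u c x = some z := by
      by_cases hm : Moves G u c x
      · obtain ⟨i, j, hs, hf⟩ := hm
        exact ⟨j, o.revPicks_of_follower hs hf⟩
      · exact ⟨y, by rw [revPicks_of_not_moves hm, hu]⟩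
    rw [hz, uniformFrom_some, uniformFrom_some, hx]
    · simp
    · simpa [nbhd] using o.adj hu
    · simpa [nbhd] using o'.adj hz

/-- Expressing the exclusion of the partner through `Matched` makes it invariant under reversal. -/
lemma mem_candidates (o : IsOutcome G u c) {i k : Fin n} :
    k ∈ (pickers G u i).filter (fun k => u i ≠ some k) ↔ u k = some i ∧ ¬ Matched u i k := by
  rw [Finset.mem_filter, o.mem_pickers]
  exact and_congr_right fun h => not_congr ⟨fun h' => ⟨h', h⟩, fun h' => h'.1⟩

lemma choiceLaw_rev (o : IsOutcome G u c) (hd : ∀ i j, deg G.graph i = deg G.graph j)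
    (hG' : nextGraph G u c = G') (β : Set.Ioo (0 : ℝ) 1) (i : Fin n) :
    choiceLaw β G' (revPicks G u c) i (revChoices G u c i) = choiceLaw β G u i (c i) := by
  have o' := o.rev hd hG'
  rw [choiceLaw_apply, choiceLaw_apply, revChoices_rule, revChoices_small]
  congr 2
  by_cases hi : ∃ j, Swaps G u c i j
  · obtain ⟨j, hs⟩ := hi
    obtain ⟨hm, hr, h, f, hh, hf, h1, h2⟩ := id hs
    have hh' := revChoices_follower hs
    rw [hf] at hh'
    have mem : h ∈ (pickers G u i).filter (fun k => u i ≠ some k) :=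
      o.mem_candidates.2 ⟨o.pick hh, fun hm => o.not_matched hh hm.symm⟩
    have mem' : f ∈ (pickers G' (revPicks G u c) i).filter (fun k => revPicks G u c i ≠ some k) :=
      o'.mem_candidates.2 ⟨o'.pick hh', fun hm => o'.not_matched hh' hm.symm⟩
    have hij := o.matched_ne hm
    -- `f` picked `j`, not `i`, so trading `h` for `f` preserves the number of candidates; the rest
    -- shows that this trade gives the candidates in `G'`.
    have hfn : f ∉ ((pickers G u i).filter (fun k => u i ≠ some k)).erase h := by
      rw [Finset.mem_erase, o.mem_candidates, o.pick hf]
      rintro ⟨-, hc, -⟩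
      cases hc
      exact hij rfl
    rw [hh, hh', uniformFrom_some mem, uniformFrom_some mem', ← Finset.card_erase_add_one mem,
      ← Finset.card_insert_of_notMem hfn]
    congr 3
    ext k
    rw [Finset.mem_insert, Finset.mem_erase, o.mem_candidates, o'.mem_candidates,
      o.matched_revPicks]
    by_cases hk : Moves G u c k
    · obtain ⟨a, b, hab, hka⟩ := hk
      have hkm : ¬ Matched u i k := fun hm => o.not_matched hka hm.symm
      rw [o.revPicks_of_follower hab hka, o.pick hka, Option.some_inj, Option.some_inj]
      constructor
      · rintro ⟨rfl, -⟩
        obtain rfl := hs.right_unique hab.symm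
        rw [hf] at hka
        cases hka
        exact Or.inl rfl
      · rintro (rfl | ⟨hne, rfl, -⟩)
        · have := o.pick hf
          rw [o.pick hka] at this
          cases this
          exact ⟨hab.right_unique hs.symm, hkm⟩
        · rw [hh] at hka
          cases hka
          exact (hne rfl).elim
    · have hkf : k ≠ f := by
        rintro rfl
        exact hk ⟨j, i, hs.symm, hf⟩
      have hkh : k ≠ h := by
        rintro rfl
        exact hk ⟨i, j, hs, hh⟩
      rw [revPicks_of_not_moves hk]
      simp [hkf, hkh]
  · rw [revChoices_of_not_swaps hi]
    suffices (pickers G' (revPicks G u c) i).filter (fun k => revPicks G u c i ≠ some k) =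
        (pickers G u i).filter (fun k => u i ≠ some k) by
      rw [this]
    ext k
    rw [o.mem_candidates, o'.mem_candidates, o.matched_revPicks, o.revPicks_eq_some_iff hi]

end IsOutcome

/-! ### Symmetry of the transition probabilities -/

/-- The probability of the picks `u` and the choices `c`. -/
noncomputable def outcomeProb (ε β : Set.Ioo (0 : ℝ) 1) (G : LabeledGraph n)
    (u : Fin n → Option (Fin n)) (c : Fin n → Choice n) : ℝ≥0∞ :=
  independent (pickLaw ε G) u * independent (choiceLaw β G u) c

lemma isOutcome_of_outcomeProb_ne_zero {ε β : Set.Ioo (0 : ℝ) 1}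
    (h : outcomeProb ε β G u c ≠ 0) : IsOutcome G u c := by
  rw [outcomeProb, independent_apply, independent_apply, mul_ne_zero_iff,
    Finset.prod_ne_zero_iff, Finset.prod_ne_zero_iff] at h
  obtain ⟨hp, hc⟩ := h
  have key : ∀ {i h}, (c i).follower = some h →
      h ∈ (pickers G u i).filter (fun k => u i ≠ some k) := by
    intro i h hh
    by_contra hmem
    refine hc i (Finset.mem_univ _) ?_
    rw [choiceLaw_apply, hh, uniformFrom_some_of_notMem hmem, zero_mul, mul_zero]
  refine ⟨?_, fun hh => ?_, fun hh => (Finset.mem_filter.1 (key hh)).2⟩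
  · intro x y hxy
    by_contra hmem
    refine hp x (Finset.mem_univ _) ?_
    rw [pickLaw_apply, hxy, uniformFrom_some_of_notMem (by simpa [nbhd] using hmem)]
    simp
  · exact (mem_pickers.1 (Finset.mem_filter.1 (key hh)).1).2

lemma IsOutcome.outcomeProb_rev (o : IsOutcome G u c)
    (hd : ∀ i j, deg G.graph i = deg G.graph j) (hG' : nextGraph G u c = G')
    (hdeg : ∀ i, deg G'.graph i = deg G.graph i) (ε β : Set.Ioo (0 : ℝ) 1) :
    outcomeProb ε β G' (revPicks G u c) (revChoices G u c) = outcomeProb ε β G u c := by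
  simp only [outcomeProb, independent_apply]
  congr 1
  · exact Finset.prod_congr rfl fun x _ => o.pickLaw_rev hd hG' ε x (hdeg x)
  · exact Finset.prod_congr rfl fun i _ => o.choiceLaw_rev hd hG' β i

open scoped Classical in
-- Discarding draws of probability zero leaves only those satisfying `IsOutcome`, as the reversal
-- lemmas require.
lemma transitionProb_eq_sum (ε β : Set.Ioo (0 : ℝ) 1) (G G' : LabeledGraph n) :
    transitionProb ε β G G' =
      ∑ x : (Fin n → Option (Fin n)) × (Fin n → Choice n) with
        outcomeProb ε β G x.1 x.2 ≠ 0 ∧ nextGraph G x.1 x.2 = G', outcomeProb ε β G x.1 x.2 := by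
  rw [transitionProb, iteration, PMF.bind_apply, tsum_fintype, Finset.sum_filter,
    Fintype.sum_prod_type]
  refine Finset.sum_congr rfl fun u _ => ?_
  rw [PMF.map_apply, tsum_fintype, Finset.mul_sum]
  refine Finset.sum_congr rfl fun c _ => ?_
  by_cases h : nextGraph G u c = G'
  · by_cases h0 : outcomeProb ε β G u c = 0
    · simp only [h, h0, if_true, ne_eq, not_true, false_and, if_false]
      exact h0
    · simp only [h, h0, if_true, ne_eq, not_false_eq_true, true_and]
      rfl
  · simp [h, Ne.symm h]

lemma transitionProb_symm (ε β : Set.Ioo (0 : ℝ) 1) {m : ℕ}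
    (hG : ∀ i, deg G.graph i = m) (hG' : ∀ i, deg G'.graph i = m) :
    transitionProb ε β G G' = transitionProb ε β G' G := by
  classical
  rw [transitionProb_eq_sum, transitionProb_eq_sum]
  -- Quantified over both graphs so that it serves for the bijection and for its inverse.
  have main : ∀ {G G' : LabeledGraph n}, (∀ i, deg G.graph i = m) → (∀ i, deg G'.graph i = m) →
      ∀ {u c}, outcomeProb ε β G u c ≠ 0 → nextGraph G u c = G' →
      outcomeProb ε β G' (revPicks G u c) (revChoices G u c) = outcomeProb ε β G u c ∧
      nextGraph G' (revPicks G u c) (revChoices G u c) = G ∧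
      revPicks G' (revPicks G u c) (revChoices G u c) = u ∧
      revChoices G' (revPicks G u c) (revChoices G u c) = c := by
    intro G G' hG hG' u c h hn
    have o := isOutcome_of_outcomeProb_ne_zero h
    have hd : ∀ i j, deg G.graph i = deg G.graph j := fun i j => by rw [hG, hG]
    have hd' : ∀ i j, deg G'.graph i = deg G'.graph j := fun i j => by rw [hG', hG']
    exact ⟨o.outcomeProb_rev hd hn (fun i => by rw [hG, hG']) ε β, o.nextGraph_rev hd hd' hn,
      o.revPicks_rev hd hn, o.revChoices_rev hd hn⟩
  refine Finset.sum_bij' (fun x _ => (revPicks G x.1 x.2, revChoices G x.1 x.2))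
    (fun x _ => (revPicks G' x.1 x.2, revChoices G' x.1 x.2)) ?_ ?_ ?_ ?_ ?_
  · intro x hx
    rw [Finset.mem_filter] at hx ⊢
    obtain ⟨h1, h2, -⟩ := main hG hG' hx.2.1 hx.2.2
    exact ⟨Finset.mem_univ _, h1.symm ▸ hx.2.1, h2⟩
  · intro x hx
    rw [Finset.mem_filter] at hx ⊢
    obtain ⟨h1, h2, -⟩ := main hG' hG hx.2.1 hx.2.2
    exact ⟨Finset.mem_univ _, h1.symm ▸ hx.2.1, h2⟩
  · intro x hx
    rw [Finset.mem_filter] at hx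
    obtain ⟨-, -, h3, h4⟩ := main hG hG' hx.2.1 hx.2.2
    exact Prod.ext h3 h4
  · intro x hx
    rw [Finset.mem_filter] at hx
    obtain ⟨-, -, h3, h4⟩ := main hG' hG hx.2.1 hx.2.2
    exact Prod.ext h3 h4
  · intro x hx
    rw [Finset.mem_filter] at hx
    exact (main hG hG' hx.2.1 hx.2.2).1.symm

lemma deg_eq_of_mem_regularStatesOfDegree {k : ℝ} {m : ℕ}
    (hG : G ∈ regularStatesOfDegree n k m) (i : Fin n) : deg G.graph i = m := by
  obtain ⟨⟨-, hr⟩, ha⟩ := hG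
  -- Truncated subtraction vanishes exactly when maximum ≤ minimum, which bounds any degree by any
  -- other.
  have hle : ∀ a b, deg G.graph a ≤ deg G.graph b := fun a b =>
    (le_ciSup (Set.finite_range _).bddAbove a).trans
      ((Nat.sub_eq_zero_iff_le.1 hr).trans (ciInf_le (OrderBot.bddBelow _) b))
  have hconst : ∀ a, deg G.graph a = deg G.graph i := fun a => (hle a i).antisymm (hle i a)
  have hn : (n : ℝ) ≠ 0 := Nat.cast_ne_zero.2 (Fin.pos i).ne'
  simp only [averageDegree, hconst, Finset.sum_const, Finset.card_univ, Fintype.card_fin,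
    nsmul_eq_mul] at ha
  rw [mul_div_cancel_left₀ _ hn] at ha
  exact_mod_cast ha

end RandReg

theorem mainTheorem5 {n : ℕ} (ε β : Set.Ioo (0 : ℝ) 1)
    (G₀ : SimpleGraph (Fin n)) (hG₀ : G₀.Connected)
    (m : ℕ) (hm : m ∈ RandReg.feasibleDegrees n (RandReg.averageDegree G₀))
    (G G' : RandReg.LabeledGraph n)
    (hG : G ∈ RandReg.regularStatesOfDegree n (RandReg.averageDegree G₀) m)
    (hG' : G' ∈ RandReg.regularStatesOfDegree n (RandReg.averageDegree G₀) m) :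
    RandReg.transitionProb ε β G G' = RandReg.transitionProb ε β G' G :=
  RandReg.transitionProb_symm ε β (RandReg.deg_eq_of_mem_regularStatesOfDegree hG)
    (RandReg.deg_eq_of_mem_regularStatesOfDegree hG')
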